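/- Let $r\ge 1$ and let $n_1,\dots,n_r$, $m_1,\dots,m_r$ be positive integers with $m_k\le n_k$ for all $k$. For matrices $A_k\in\mathbb R^{n_k\times m_k}$ and a tensor $S\in\mathbb R^{m_1\times\cdots\times m_r}$ let $\boldsymbol A\cdot S\in\mathbb R^{n_1\times\cdots\times n_r}$ be the Tucker product $$(\boldsymbol A\cdot S)_{i_1,\dots,i_r}=\sum_{j_1=1}^{m_1}\cdots\sum_{j_r=1}^{m_r}(A_1)_{i_1j_1}\cdots(A_r)_{i_rj_r}\,S_{j_1,\dots,j_r},$$ and let $$\mathcal M(m_1,\dots,m_r)=\{\boldsymbol A\cdot S:\ A_k\in\mathbb R^{n_k\times m_k}\ (k=1,\dots,r),\ S\in\mathbb R^{m_1\times\cdots\times m_r}\}.$$ The multilinear rank of $T\in\mathbb R^{n_1\times\cdots\times n_r}$ is the tuple whose $k$-th entry is the rank of the $n_k\times\prod_{l\ne k}n_l$ matrix whose columns are the mode-$k$ fibers of $T$. Let $\mathcal T(d_1,\dots,d_r)$ be the set of tensors in $\mathbb R^{n_1\times\cdots\times n_r}$ of multilinear rank exactly $(d_1,\dots,d_r)$, and let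 $$\overline{\mathcal T}(d_1,\dots,d_r)=\bigcup_{d_1'\le d_1,\dots,d_r'\le d_r}\mathcal T(d_1',\dots,d_r')$$ be the Tucker (subspace) variety. Then, with $d_k=\min\{m_k,\prod_{l\ne k}m_l\}$, $$\mathcal M(m_1,\dots,m_r)=\overline{\mathcal T}(d_1,\dots,d_r),$$ and the dimension of this real algebraic set (the Krull dimension of its ring of real polynomial functions) is $$\dim\mathcal M(m_1,\dots,m_r)=\sum_{k=1}^r\bigl(d_kn_k-d_k^2\bigr)+\prod_{k=1}^r d_k.$$ -/

import Mathlib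

/-- Real arrays of format `n 1 × ⋯ × n r`. -/
abbrev RealTensor {r : ℕ} (n : Fin r → ℕ) : Type :=
  (∀ k, Fin (n k)) → ℝ

/-- The Tucker product `A · S`, whose entry at `(i₁, …, i_r)` is
`∑_{j₁, …, j_r} (A₁)_{i₁ j₁} ⋯ (A_r)_{i_r j_r} S_{j₁ … j_r}`. -/
def tuckerProduct {r : ℕ} {n m : Fin r → ℕ}
    (A : ∀ k, Matrix (Fin (n k)) (Fin (m k)) ℝ) (S : RealTensor m) : RealTensor n :=
  fun i => ∑ j, (∏ k, A k (i k) (j k)) * S j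

/-- The mode-`k` matricization: the `n k × ∏_{l ≠ k} n l` matrix whose columns are the
mode-`k` fibers of `T`. -/
def modeMatricization {r : ℕ} {n : Fin r → ℕ} (k : Fin r) (T : RealTensor n) :
    Matrix (Fin (n k)) (∀ l : {l : Fin r // l ≠ k}, Fin (n l)) ℝ :=
  Matrix.of fun i j => T ((Equiv.piSplitAt k fun l => Fin (n l)).symm (i, j))

/-- The multilinear (Tucker) rank of a tensor. -/
noncomputable def multilinearRank {r : ℕ} {n : Fin r → ℕ} (T : RealTensor n) : Fin r → ℕ :=
  fun k => (modeMatricization k T).rank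

/-- The Tucker manifold: the tensors of format `n` whose multilinear rank is exactly `d`. -/
def tuckerManifold {r : ℕ} (n d : Fin r → ℕ) : Set (RealTensor n) :=
  {T | multilinearRank T = d}

/-- The Tucker (subspace) variety: the union of the Tucker manifolds of multilinear
rank `d' ≤ d` (componentwise). -/
def tuckerVariety {r : ℕ} (n d : Fin r → ℕ) : Set (RealTensor n) :=
  ⋃ d' ∈ Set.Iic d, tuckerManifold n d'

/-- The set of all tensors `A · S` of format `n`, where `A k` ranges over all `n k × m k` matrices
and `S` over all core tensors of format `m`. -/
def tuckerImage {r : ℕ} (n m : Fin r → ℕ) : Set (RealTensor n) :=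
  {T | ∃ (A : ∀ k, Matrix (Fin (n k)) (Fin (m k)) ℝ) (S : RealTensor m), T = tuckerProduct A S}

/-- `d_k = min {m_k, ∏_{l ≠ k} m_l}`. -/
def effectiveRank {r : ℕ} (m : Fin r → ℕ) (k : Fin r) : ℕ :=
  min (m k) (∏ l ∈ Finset.univ.erase k, m l)

/-- The dimension of a real algebraic (or semialgebraic) subset `X` of `ℝ^σ`: the Krull dimension
of its ring of polynomial functions `ℝ[x_i : i ∈ σ] / I(X)`. -/
noncomputable def realAlgebraicDim {σ : Type} (X : Set (σ → ℝ)) : WithBot ℕ∞ :=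
  ringKrullDim (MvPolynomial σ ℝ ⧸ MvPolynomial.vanishingIdeal ℝ X)

/-!
A tensor lies in `tuckerVariety n m` iff each of its matricizations `T₍ₖ₎` has rank at most `m k`.
A rank factorization then gives `P k * Q k * T₍ₖ₎ = T₍ₖ₎`, and applying `P k * Q k` in every mode
fixes `T`, so `T` is the Tucker product of the `P k` with core `Q · T`. Conversely
`(A · S)₍ₖ₎ = A k * S₍ₖ₎ * (Kronecker product)ᵀ`, where `S₍ₖ₎` has format `m k × ∏_{l ≠ k} m l`.

For the dimension, put `d = effectiveRank m`. Factors whose top `d k × d k` block is the identity,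
together with arbitrary cores, parametrize a dense subset of the variety, so its coordinate ring is
the algebra generated by the entries of this parametrization, and its dimension is the
transcendence degree of that algebra. The entries whose row indices are all at most `d` are the
core variables. A mode-`k` row of free factor entries is multiplied by the matricized core to give
further entries of the tensor, and because `d k ≤ ∏_{l ≠ k} d l` some `d k` columns of the
matricized core form a square matrix of distinct variables, with nonzero determinant. By Cramer's
rule every variable is then algebraic over the algebra, so the dimension is the number of variables.
-/

section KrullDimension

theorem ringKrullDim_eq_of_isIntegral {R S : Type*} [CommRing R] [CommRing S] [Algebra R S]
    [Algebra.IsIntegral R S] [FaithfulSMul R S] : ringKrullDim R = ringKrullDim S := by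
  apply le_antisymm
  · refine iSup_le fun chain => ?_
    obtain ⟨Q, -, _, hQ⟩ := Ideal.exists_ideal_over_prime_of_isIntegral (S := S)
      chain.head.asIdeal ⊥ (by
        rw [← RingHom.ker_eq_comap_bot, (RingHom.injective_iff_ker_eq_bot _).mp
          (FaithfulSMul.algebraMap_injective R S)]
        exact bot_le)
    have : Q.LiesOver chain.head.asIdeal := ⟨hQ.symm⟩
    obtain ⟨lift, hlift, -⟩ := Ideal.exists_ltSeries_of_hasGoingUp chain Q
    exact hlift ▸ Order.LTSeries.length_le_krullDim lift
  · exact Order.krullDim_le_of_strictMono (PrimeSpectrum.comap (algebraMap R S))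
      fun _ _ h => Ideal.IsIntegral.comap_lt_comap h

theorem toNat_trdeg_eq_of_isAlgebraic (R : Type*) {S A : Type*} [CommRing R] [Nontrivial R]
    [CommRing S] [CommRing A] [NoZeroDivisors A] [Algebra R S] [Algebra R A] [Algebra S A]
    [IsScalarTower R S A] [FaithfulSMul R S] [FaithfulSMul S A] [Algebra.IsAlgebraic S A] :
    Cardinal.toNat (Algebra.trdeg R S) = Cardinal.toNat (Algebra.trdeg R A) := by
  have h := congrArg Cardinal.toNat (lift_trdeg_add_eq R S A)
  simpa only [trdeg_eq_zero, Cardinal.lift_zero, add_zero, Cardinal.toNat_lift] using h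

theorem ringKrullDim_eq_trdeg (k A : Type*) [Field k] [CommRing A] [IsDomain A] [Algebra k A]
    [Algebra.FiniteType k A] : ringKrullDim A = Cardinal.toNat (Algebra.trdeg k A) := by
  obtain ⟨s, g, hg, hint⟩ := exists_integral_inj_algHom_of_fg k A
  algebraize [g.toRingHom]
  have : Algebra.IsIntegral (MvPolynomial (Fin s) k) A := ⟨hint⟩
  have : FaithfulSMul (MvPolynomial (Fin s) k) A :=
    (faithfulSMul_iff_algebraMap_injective _ _).mpr hg
  rw [← toNat_trdeg_eq_of_isAlgebraic k (S := MvPolynomial (Fin s) k),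
    ← ringKrullDim_eq_of_isIntegral (R := MvPolynomial (Fin s) k) (S := A),
    MvPolynomial.ringKrullDim_of_isNoetherianRing, MvPolynomial.trdeg_of_isDomain]
  simp

theorem isAlgebraic_of_exists_mul_mem {k A : Type*} [CommRing k] [CommRing A] [IsDomain A]
    [Algebra k A] {B : Subalgebra k A} {t : Set A} (ht : Algebra.adjoin k t = ⊤)
    (h : ∀ x ∈ t, ∃ s ∈ B, s ≠ 0 ∧ s * x ∈ B) : Algebra.IsAlgebraic B A := by
  have hle : Algebra.adjoin k t ≤ (Subalgebra.algebraicClosure B A).restrictScalars k := by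
    refine Algebra.adjoin_le fun x hx => ?_
    obtain ⟨s, hs, hs0, hsx⟩ := h x hx
    exact IsAlgebraic.of_mul (mem_nonZeroDivisors_of_ne_zero hs0)
      (isAlgebraic_algebraMap (⟨s, hs⟩ : B)) (isAlgebraic_algebraMap (⟨s * x, hsx⟩ : B))
  exact ⟨fun x => hle (ht ▸ Algebra.mem_top)⟩

end KrullDimension

section VanishingIdeal

open MvPolynomial

variable {σ τ K : Type*} [Field K]

theorem vanishingIdeal_closure [TopologicalSpace K] [IsTopologicalRing K] [T1Space K]
    (X : Set (σ → K)) : vanishingIdeal K (closure X) = vanishingIdeal K X := by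
  refine (vanishingIdeal_anti_mono subset_closure).antisymm fun f hf => ?_
  simp only [mem_vanishingIdeal_iff, aeval_eq_eval] at hf ⊢
  exact closure_minimal hf (isClosed_singleton.preimage (continuous_eval f))

theorem vanishingIdeal_range_eval [Infinite K] (p : σ → MvPolynomial τ K) :
    vanishingIdeal K (Set.range fun x i => eval x (p i)) = RingHom.ker (aeval (R := K) p) := by
  ext f
  have eval_aeval (x : τ → K) : eval x (aeval p f) = eval (fun i => eval x (p i)) f := by
    simp only [← aeval_eq_eval, ← comp_aeval_apply]
  simp only [mem_vanishingIdeal_iff, Set.forall_mem_range, aeval_eq_eval, RingHom.mem_ker,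
    ← eval_aeval]
  exact ⟨fun h => MvPolynomial.funext fun x => by rw [h, map_zero], fun h x => by rw [h, map_zero]⟩

theorem ringKrullDim_quotient_vanishingIdeal_range_eval [Infinite K] [Finite σ]
    (p : σ → MvPolynomial τ K)
    [halg : Algebra.IsAlgebraic (Algebra.adjoin K (Set.range p)) (MvPolynomial τ K)] :
    ringKrullDim (MvPolynomial σ K ⧸ vanishingIdeal K (Set.range fun x i => eval x (p i))) =
      Nat.card τ := by
  rw [Algebra.adjoin_range_eq_range_aeval] at halg
  have : Algebra.FiniteType K (aeval (R := K) p).range :=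
    .of_surjective (aeval p).rangeRestrict (aeval p).rangeRestrict_surjective
  rw [vanishingIdeal_range_eval,
    ringKrullDim_eq_of_ringEquiv (Ideal.quotientKerEquivRange (aeval (R := K) p)).toRingEquiv,
    ringKrullDim_eq_trdeg K, toNat_trdeg_eq_of_isAlgebraic K (A := MvPolynomial τ K),
    trdeg_of_isDomain, Cardinal.toNat_lift]
  rfl

end VanishingIdeal

section Matrices

open Filter Topology

variable {ι κ : Type*} [Fintype ι]

theorem exists_mul_mul_eq_self_of_rank_le {K μ : Type*} [Field K] [Fintype κ] [Fintype μ]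
    (M : Matrix κ ι K) (h : M.rank ≤ Fintype.card μ) :
    ∃ (P : Matrix κ μ K) (Q : Matrix μ κ K), P * Q * M = M := by
  classical
  let V := LinearMap.range M.mulVecLin
  obtain ⟨π, hπ⟩ := V.subtype.exists_leftInverse_of_injective V.ker_subtype
  obtain ⟨f, hf⟩ : ∃ f : V →ₗ[K] (μ → K), Function.Injective f := by
    rw [← lift_rank_le_iff_exists_linearMap, ← Module.finrank_eq_rank, ← Module.finrank_eq_rank,
      Cardinal.lift_natCast, Cardinal.lift_natCast, Nat.cast_le, Module.finrank_fintype_fun_eq_card]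
    exact h
  obtain ⟨g, hg⟩ := f.exists_leftInverse_of_injective (LinearMap.ker_eq_bot.mpr hf)
  refine ⟨LinearMap.toMatrix' (V.subtype ∘ₗ g), LinearMap.toMatrix' (f ∘ₗ π), ?_⟩
  apply Matrix.toLin'.injective
  rw [Matrix.toLin'_mul, Matrix.toLin'_mul, Matrix.toLin'_toMatrix', Matrix.toLin'_toMatrix']
  refine LinearMap.ext fun v => ?_
  have hv : Matrix.toLin' M v = V.subtype ⟨M.mulVecLin v, v, rfl⟩ := rfl
  have hπ_apply (w) : π (V.subtype w) = w := LinearMap.congr_fun hπ w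
  have hg_apply (w) : g (f w) = w := LinearMap.congr_fun hg w
  simp only [LinearMap.comp_apply, hv, hπ_apply, hg_apply]

variable [DecidableEq ι]

theorem det_mem {A S : Type*} [CommRing A] [SetLike S A] [SubringClass S A] {B : S}
    {N : Matrix ι ι A} (hN : ∀ i j, N i j ∈ B) : N.det ∈ B := by
  rw [Matrix.det_apply']
  exact sum_mem fun _ _ => mul_mem (intCast_mem _ _) (prod_mem fun _ _ => hN _ _)

theorem det_mul_mem_of_vecMul_mem {A S : Type*} [CommRing A] [SetLike S A] [SubringClass S A]
    {B : S} {N : Matrix ι ι A} {y : ι → A} (hN : ∀ i j, N i j ∈ B)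
    (hy : ∀ j, Matrix.vecMul y N j ∈ B) (i : ι) : N.det * y i ∈ B := by
  have cramer : (N.updateRow i (Matrix.vecMul y N)).det = N.det * y i := by
    rw [Matrix.vecMul_eq_sum, Matrix.det_updateRow_sum, smul_eq_mul, mul_comm]
  rw [← cramer]
  refine det_mem fun a b => ?_
  rw [Matrix.updateRow_apply]
  split_ifs
  exacts [hy b, hN a b]

theorem det_of_X_ne_zero {R τ : Type*} [CommRing R] [Nontrivial R] {f : ι → ι → τ}
    (hf : Function.Injective2 f) :
    (Matrix.of fun i j => (MvPolynomial.X (f i j) : MvPolynomial τ R)).det ≠ 0 := by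
  have h : (Matrix.of fun i j => (MvPolynomial.X (f i j) : MvPolynomial τ R)) =
      (MvPolynomial.rename (R := R) (Function.uncurry f)).mapMatrix
        (Matrix.mvPolynomialX ι ι R) := by
    ext1 i j
    simp
  rw [h, ← AlgHom.map_det, map_ne_zero_iff _ (MvPolynomial.rename_injective _ hf.uncurry)]
  exact Matrix.det_mvPolynomialX_ne_zero ι R

theorem eventually_det_add_smul_one_ne_zero {K : Type*} [Field K] [TopologicalSpace K] [T1Space K]
    (U : Matrix ι ι K) : ∀ᶠ t : K in 𝓝[≠] 0, (U + t • (1 : Matrix ι ι K)).det ≠ 0 := by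
  have hfin : {t | (-U).charpoly.IsRoot t}.Finite :=
    Polynomial.finite_setOfPred_isRoot (-U).charpoly_monic.ne_zero
  filter_upwards [nhdsNE_le_cofinite 0 hfin.compl_mem_cofinite] with t ht hdet
  refine ht ?_
  change (-U).charpoly.eval t = 0
  rw [Matrix.eval_charpoly, sub_neg_eq_add, add_comm, ← hdet, Matrix.smul_one_eq_diagonal,
    Matrix.scalar_apply]

end Matrices

section Tucker

variable {r : ℕ} {n m : Fin r → ℕ}

theorem tuckerProduct_tuckerProduct {l : Fin r → ℕ}
    (A : ∀ k, Matrix (Fin (n k)) (Fin (m k)) ℝ) (B : ∀ k, Matrix (Fin (m k)) (Fin (l k)) ℝ)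
    (S : RealTensor l) :
    tuckerProduct A (tuckerProduct B S) = tuckerProduct (fun k => A k * B k) S := by
  funext i
  simp only [tuckerProduct, Matrix.mul_apply, Fintype.prod_sum, Finset.sum_mul, Finset.mul_sum]
  rw [Finset.sum_comm]
  refine Finset.sum_congr rfl fun _ _ => Finset.sum_congr rfl fun _ _ => ?_
  rw [Finset.prod_mul_distrib, mul_assoc]

theorem tuckerProduct_one (T : RealTensor n) :
    tuckerProduct (1 : ∀ k, Matrix (Fin (n k)) (Fin (n k)) ℝ) T = T := by
  funext i
  simp [tuckerProduct, Matrix.one_apply, Fintype.prod_ite_zero, ← funext_iff]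

theorem modeMatricization_injective (k : Fin r) :
    Function.Injective (modeMatricization (n := n) k) := by
  intro S T h
  funext i
  have hentry := congrFun (congrFun h (Equiv.piSplitAt k (fun l => Fin (n l)) i).1)
    (Equiv.piSplitAt k (fun l => Fin (n l)) i).2
  simpa only [modeMatricization, Matrix.of_apply, Prod.mk.eta, Equiv.symm_apply_apply] using hentry

/-- The Kronecker product of the factors in all modes but `k`, its rows and columns being indexed
by multi-indices that omit `k`. It describes how a Tucker product acts on the columns of the
mode-`k` matricization. -/
def kroneckerExcept (k : Fin r) (A : ∀ k, Matrix (Fin (n k)) (Fin (m k)) ℝ) :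
    Matrix (∀ l : {l : Fin r // l ≠ k}, Fin (n l)) (∀ l : {l : Fin r // l ≠ k}, Fin (m l)) ℝ :=
  Matrix.of fun i j => ∏ l : {l : Fin r // l ≠ k}, A l (i l) (j l)

theorem modeMatricization_tuckerProduct (k : Fin r)
    (A : ∀ k, Matrix (Fin (n k)) (Fin (m k)) ℝ) (S : RealTensor m) :
    modeMatricization k (tuckerProduct A S) =
      A k * modeMatricization k S * (kroneckerExcept k A).transpose := by
  ext a b
  simp only [modeMatricization, Matrix.of_apply, tuckerProduct, Matrix.mul_apply,
    Matrix.transpose_apply, kroneckerExcept, Finset.sum_mul]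
  rw [← Equiv.sum_comp (Equiv.piSplitAt k fun l => Fin (m l)).symm, Fintype.sum_prod_type_right]
  refine Finset.sum_congr rfl fun c _ => Finset.sum_congr rfl fun j _ => ?_
  have off_mode (l : {l : Fin r // l ≠ k}) :
      A l ((Equiv.piSplitAt k fun l => Fin (n l)).symm (a, b) l)
        ((Equiv.piSplitAt k fun l => Fin (m l)).symm (j, c) l) = A l (b l) (c l) := by
    simp [Equiv.piSplitAt, l.2]
  simp only [Fintype.prod_eq_mul_prod_subtype_ne _ k, off_mode]
  simp only [Equiv.piSplitAt, Equiv.coe_fn_symm_mk, dite_true]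
  ring

theorem kroneckerExcept_mulSingle (k : Fin r) (C : Matrix (Fin (n k)) (Fin (n k)) ℝ) :
    kroneckerExcept k (Pi.mulSingle k C) = 1 := by
  ext i j
  have off_mode (l : {l : Fin r // l ≠ k}) :
      (Pi.mulSingle k C : ∀ k, Matrix (Fin (n k)) (Fin (n k)) ℝ) l = 1 :=
    Pi.mulSingle_eq_of_ne (M := fun k => Matrix (Fin (n k)) (Fin (n k)) ℝ) l.2 C
  simp [kroneckerExcept, off_mode, Matrix.one_apply, Fintype.prod_ite_zero, ← funext_iff]

theorem tuckerProduct_eq_self_of_mul_modeMatricization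
    {C : ∀ k, Matrix (Fin (n k)) (Fin (n k)) ℝ} {T : RealTensor n}
    (h : ∀ k, C k * modeMatricization k T = modeMatricization k T) : tuckerProduct C T = T := by
  let stabilizer : Submonoid (∀ k, Matrix (Fin (n k)) (Fin (n k)) ℝ) :=
    { carrier := {A | tuckerProduct A T = T}
      one_mem' := tuckerProduct_one T
      mul_mem' := fun {A B} (hA : tuckerProduct A T = T) (hB : tuckerProduct B T = T) =>
        (tuckerProduct_tuckerProduct A B T).symm.trans (by rw [hB, hA]) }
  suffices C ∈ stabilizer from this
  refine Submonoid.pi_mem_of_mulSingle_mem C fun k => modeMatricization_injective k ?_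
  rw [modeMatricization_tuckerProduct, kroneckerExcept_mulSingle, Matrix.transpose_one,
    Matrix.mul_one, Pi.mulSingle_eq_same, h]

theorem mem_tuckerVariety_iff {d : Fin r → ℕ} {T : RealTensor n} :
    T ∈ tuckerVariety n d ↔ ∀ k, (modeMatricization k T).rank ≤ d k := by
  simp only [tuckerVariety, tuckerManifold, Set.mem_iUnion, Set.mem_ofPred_eq, Set.mem_Iic,
    exists_prop, exists_eq_right']
  rfl

theorem tuckerVariety_mono {d e : Fin r → ℕ} (h : d ≤ e) :
    tuckerVariety n d ⊆ tuckerVariety n e := fun _ hT =>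
  mem_tuckerVariety_iff.mpr fun k => (mem_tuckerVariety_iff.mp hT k).trans (h k)

theorem tuckerVariety_inf (n d : Fin r → ℕ) : tuckerVariety n (d ⊓ n) = tuckerVariety n d := by
  refine (tuckerVariety_mono inf_le_left).antisymm fun T hT => mem_tuckerVariety_iff.mpr fun k => ?_
  exact le_inf (mem_tuckerVariety_iff.mp hT k)
    ((Matrix.rank_le_card_height _).trans_eq (Fintype.card_fin _))

theorem tuckerVariety_subset_tuckerImage (n m : Fin r → ℕ) :
    tuckerVariety n m ⊆ tuckerImage n m := by
  intro T hT
  choose P Q h using fun k => exists_mul_mul_eq_self_of_rank_le (μ := Fin (m k))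
    (modeMatricization k T) (by simpa using mem_tuckerVariety_iff.mp hT k)
  refine ⟨P, tuckerProduct Q T, ?_⟩
  rw [tuckerProduct_tuckerProduct, tuckerProduct_eq_self_of_mul_modeMatricization h]

theorem card_multiIndex_except (m : Fin r → ℕ) (k : Fin r) :
    Fintype.card (∀ l : {l : Fin r // l ≠ k}, Fin (m l)) = ∏ l ∈ Finset.univ.erase k, m l := by
  simp only [Fintype.card_pi, Fintype.card_fin]
  exact (Finset.prod_subtype _ (by simp) _).symm

theorem tuckerImage_subset_tuckerVariety_effectiveRank (n m : Fin r → ℕ) :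
    tuckerImage n m ⊆ tuckerVariety n (effectiveRank m) := by
  rintro T ⟨A, S, rfl⟩
  refine mem_tuckerVariety_iff.mpr fun k => ?_
  rw [modeMatricization_tuckerProduct]
  calc (A k * modeMatricization k S * (kroneckerExcept k A).transpose).rank
      ≤ (modeMatricization k S).rank :=
        (Matrix.rank_mul_le_left _ _).trans (Matrix.rank_mul_le_right _ _)
    _ ≤ effectiveRank m k :=
        le_min ((Matrix.rank_le_card_height _).trans_eq (Fintype.card_fin _))
          ((Matrix.rank_le_card_width _).trans_eq (card_multiIndex_except m k))

theorem effectiveRank_le (m : Fin r → ℕ) : effectiveRank m ≤ m := fun _ => min_le_left _ _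

theorem tuckerImage_eq_tuckerVariety (n m : Fin r → ℕ) : tuckerImage n m = tuckerVariety n m :=
  ((tuckerImage_subset_tuckerVariety_effectiveRank n m).trans
    (tuckerVariety_mono (effectiveRank_le m))).antisymm (tuckerVariety_subset_tuckerImage n m)

theorem tuckerVariety_effectiveRank (n m : Fin r → ℕ) :
    tuckerVariety n (effectiveRank m) = tuckerVariety n m := by
  refine (tuckerVariety_mono (effectiveRank_le m)).antisymm ?_
  rw [← tuckerImage_eq_tuckerVariety]
  exact tuckerImage_subset_tuckerVariety_effectiveRank n m

theorem pos_of_effectiveRank_pos {m : Fin r → ℕ} {k : Fin r} (h : 0 < effectiveRank m k)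
    (l : Fin r) : 0 < m l := by
  obtain ⟨hk, hprod⟩ := lt_min_iff.mp h
  by_cases hlk : l = k
  · exact hlk ▸ hk
  · exact Nat.pos_of_ne_zero fun hl =>
      hprod.ne' (Finset.prod_eq_zero (Finset.mem_erase.mpr ⟨hlk, Finset.mem_univ l⟩) hl)

theorem effectiveRank_le_prod_erase (m : Fin r → ℕ) (k : Fin r) :
    effectiveRank m k ≤ ∏ l ∈ Finset.univ.erase k, effectiveRank m l := by
  obtain hk | hk := Nat.eq_zero_or_pos (effectiveRank m k)
  · exact hk ▸ Nat.zero_le _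
  have hm := pos_of_effectiveRank_pos hk
  have prod_pos (l : Fin r) : 0 < ∏ i ∈ Finset.univ.erase l, m i := Finset.prod_pos fun i _ => hm i
  by_cases htrunc : ∀ l ∈ Finset.univ.erase k, effectiveRank m l = m l
  · exact Finset.prod_congr rfl htrunc ▸ min_le_right _ _
  -- A truncated mode `l ≠ k` has `m k` among the factors of its effective rank.
  push Not at htrunc
  obtain ⟨l, hl, hlm⟩ := htrunc
  have hkl : k ∈ Finset.univ.erase l := by simpa [eq_comm] using hl
  calc effectiveRank m k ≤ m k := min_le_left _ _
    _ ≤ ∏ i ∈ Finset.univ.erase l, m i :=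
        Nat.le_of_dvd (prod_pos l) (Finset.dvd_prod_of_mem _ hkl)
    _ = effectiveRank m l := ((min_choice _ _).resolve_left hlm).symm
    _ ≤ ∏ i ∈ Finset.univ.erase k, effectiveRank m i :=
        Nat.le_of_dvd (Finset.prod_pos fun i _ => lt_min (hm i) (prod_pos i))
          (Finset.dvd_prod_of_mem _ hl)

end Tucker

section Chart

open Filter Topology

variable {r : ℕ} {n d : Fin r → ℕ}

/-- The coordinates of the standard chart of the Tucker variety: the entries of the factors
below the identity block, and the entries of the core tensor. -/
abbrev ChartIndex (n d : Fin r → ℕ) : Type :=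
  (Σ k, {i : Fin (n k) // d k ≤ (i : ℕ)} × Fin (d k)) ⊕ (∀ k, Fin (d k))

/-- The factor whose top `d k × d k` block is the identity and whose remaining entries
are given by `x`. -/
def chartFactor {R : Type*} [Zero R] [One R] (x : ChartIndex n d → R) (k : Fin r) :
    Matrix (Fin (n k)) (Fin (d k)) R :=
  Matrix.of fun i j => if h : d k ≤ (i : ℕ) then x (Sum.inl ⟨k, ⟨i, h⟩, j⟩)
    else if (i : ℕ) = j then 1 else 0

/-- The standard chart of the Tucker variety, which sends coordinates `x` to the Tucker product of
the factors `chartFactor x k` with the core entries of `x`. It is defined over any commutative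
semiring so that substituting the variables `MvPolynomial.X` gives the polynomials that define
it. -/
def tuckerChart {R : Type*} [CommSemiring R] (n d : Fin r → ℕ) (x : ChartIndex n d → R)
    (i : ∀ k, Fin (n k)) : R :=
  ∑ j : ∀ k, Fin (d k), (∏ k, chartFactor x k (i k) (j k)) * x (Sum.inr j)

theorem chartFactor_castLE {R : Type*} [Zero R] [One R] (hd : ∀ k, d k ≤ n k)
    (x : ChartIndex n d → R) (k : Fin r) (i j : Fin (d k)) :
    chartFactor x k (Fin.castLE (hd k) i) j = if i = j then 1 else 0 := by
  simp [chartFactor, Fin.ext_iff]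

theorem chartFactor_of_le {R : Type*} [Zero R] [One R] (x : ChartIndex n d → R) {k : Fin r}
    (i : {i : Fin (n k) // d k ≤ (i : ℕ)}) (j : Fin (d k)) :
    chartFactor x k i j = x (Sum.inl ⟨k, i, j⟩) := by
  simp [chartFactor, i.2]

theorem map_tuckerChart {R S : Type*} [CommSemiring R] [CommSemiring S] (f : R →+* S)
    (x : ChartIndex n d → R) (i : ∀ k, Fin (n k)) :
    f (tuckerChart n d x i) = tuckerChart n d (f ∘ x) i := by
  simp [tuckerChart, chartFactor, apply_dite f, apply_ite f]

theorem tuckerChart_eq_tuckerProduct (x : ChartIndex n d → ℝ) :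
    tuckerChart n d x = tuckerProduct (chartFactor x) (x ∘ Sum.inr) := rfl

theorem range_tuckerChart_subset_tuckerImage (n d : Fin r → ℕ) :
    Set.range (tuckerChart (R := ℝ) n d) ⊆ tuckerImage n d := by
  rintro _ ⟨x, rfl⟩
  exact ⟨_, _, tuckerChart_eq_tuckerProduct x⟩

theorem tuckerProduct_mem_range_tuckerChart (hd : ∀ k, d k ≤ n k)
    (A : ∀ k, Matrix (Fin (n k)) (Fin (d k)) ℝ) (S : RealTensor d)
    (hA : ∀ k, ((A k).submatrix (Fin.castLE (hd k)) id).det ≠ 0) :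
    tuckerProduct A S ∈ Set.range (tuckerChart (R := ℝ) n d) := by
  let U (k) : Matrix (Fin (d k)) (Fin (d k)) ℝ := (A k).submatrix (Fin.castLE (hd k)) id
  have hU (k) : IsUnit (U k).det := (hA k).isUnit
  let x : ChartIndex n d → ℝ :=
    Sum.elim (fun b => (A b.1 * (U b.1)⁻¹) b.2.1 b.2.2) (tuckerProduct U S)
  have hx (k) : chartFactor x k = A k * (U k)⁻¹ := by
    ext i j
    by_cases h : d k ≤ (i : ℕ)
    · exact chartFactor_of_le x ⟨i, h⟩ j
    · obtain ⟨i, rfl⟩ : ∃ i', i = Fin.castLE (hd k) i' := ⟨⟨i, not_le.mp h⟩, rfl⟩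
      rw [chartFactor_castLE, ← Matrix.one_apply, ← Matrix.mul_nonsing_inv _ (hU k)]
      rfl
  refine ⟨x, ?_⟩
  calc tuckerChart n d x = tuckerProduct (chartFactor x) (tuckerProduct U S) := rfl
    _ = tuckerProduct A S := by
      simp only [tuckerProduct_tuckerProduct, hx, Matrix.nonsing_inv_mul_cancel_right _ _ (hU _)]

theorem continuous_tuckerProduct_left (S : RealTensor d) :
    Continuous fun A : ∀ k, Matrix (Fin (n k)) (Fin (d k)) ℝ => tuckerProduct A S := by
  unfold tuckerProduct
  fun_prop

theorem tuckerImage_subset_closure_range_tuckerChart (hd : ∀ k, d k ≤ n k) :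
    tuckerImage n d ⊆ closure (Set.range (tuckerChart (R := ℝ) n d)) := by
  rintro _ ⟨A, S, rfl⟩
  let E (k) : Matrix (Fin (n k)) (Fin (d k)) ℝ :=
    Matrix.of fun i j => if (i : ℕ) = j then 1 else 0
  have hE (k) : (E k).submatrix (Fin.castLE (hd k)) id = 1 := by
    ext i j
    simp [E, Matrix.one_apply, Fin.ext_iff]
  have hlim : Tendsto (fun t : ℝ => tuckerProduct (fun k => A k + t • E k) S) (𝓝[≠] 0)
      (𝓝 (tuckerProduct A S)) := by
    have hcont : Continuous fun t : ℝ => tuckerProduct (fun k => A k + t • E k) S :=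
      (continuous_tuckerProduct_left S).comp (by fun_prop)
    simpa using (hcont.tendsto 0).mono_left nhdsWithin_le_nhds
  refine mem_closure_of_tendsto hlim ?_
  filter_upwards [eventually_all.mpr fun k => eventually_det_add_smul_one_ne_zero
    ((A k).submatrix (Fin.castLE (hd k)) id)] with t ht
  refine tuckerProduct_mem_range_tuckerChart hd _ S fun k => ?_
  rw [Matrix.submatrix_add, Matrix.submatrix_smul]
  simpa only [Pi.add_apply, Pi.smul_apply, hE] using ht k

theorem vanishingIdeal_tuckerImage (hd : ∀ k, d k ≤ n k) :
    MvPolynomial.vanishingIdeal ℝ (tuckerImage n d) =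
      MvPolynomial.vanishingIdeal ℝ (Set.range (tuckerChart (R := ℝ) n d)) :=
  (MvPolynomial.vanishingIdeal_anti_mono
    (range_tuckerChart_subset_tuckerImage n d)).antisymm <| by
    rw [← vanishingIdeal_closure (Set.range _)]
    exact MvPolynomial.vanishingIdeal_anti_mono (tuckerImage_subset_closure_range_tuckerChart hd)

theorem tuckerChart_castLE {R : Type*} [CommSemiring R] (hd : ∀ k, d k ≤ n k)
    (x : ChartIndex n d → R) (j : ∀ k, Fin (d k)) :
    tuckerChart n d x (fun k => Fin.castLE (hd k) (j k)) = x (Sum.inr j) := by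
  simp [tuckerChart, chartFactor_castLE, Fintype.prod_ite_zero, ← funext_iff]

theorem tuckerChart_fiber {R : Type*} [CommSemiring R] (hd : ∀ k, d k ≤ n k)
    (x : ChartIndex n d → R) (k : Fin r) (a : Fin (n k))
    (c : ∀ l : {l : Fin r // l ≠ k}, Fin (d l)) :
    tuckerChart n d x ((Equiv.piSplitAt k fun l => Fin (n l)).symm
        (a, fun l => Fin.castLE (hd l) (c l))) =
      ∑ j, chartFactor x k a j *
        x (Sum.inr ((Equiv.piSplitAt k fun l => Fin (d l)).symm (j, c))) := by
  have off_mode (j : Fin (d k)) (c' : ∀ l : {l : Fin r // l ≠ k}, Fin (d l))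
      (l : {l : Fin r // l ≠ k}) : chartFactor x l
        ((Equiv.piSplitAt k fun l => Fin (n l)).symm (a, fun l => Fin.castLE (hd l) (c l)) l)
        ((Equiv.piSplitAt k fun l => Fin (d l)).symm (j, c') l) =
      if c l = c' l then 1 else 0 := by
    simp [Equiv.piSplitAt, l.2, chartFactor_castLE]
  rw [tuckerChart, ← Equiv.sum_comp (Equiv.piSplitAt k fun l => Fin (d l)).symm,
    Fintype.sum_prod_type]
  refine Finset.sum_congr rfl fun j _ => ?_
  simp only [Fintype.prod_eq_mul_prod_subtype_ne _ k, off_mode, Fintype.prod_ite_zero,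
    ← funext_iff]
  simp [Equiv.piSplitAt]

/-- The algebra generated by the entries of the generic point of the chart. Over `ℝ` it is the
coordinate ring of the Tucker variety if `d ≤ n`. -/
noncomputable abbrev tuckerChartAlgebra (R : Type*) [CommSemiring R] (n d : Fin r → ℕ) :
    Subalgebra R (MvPolynomial (ChartIndex n d) R) :=
  Algebra.adjoin R (Set.range (tuckerChart n d MvPolynomial.X))

theorem exists_mul_X_mem_tuckerChartAlgebra {R : Type*} [CommRing R] [Nontrivial R]
    (hd : ∀ k, d k ≤ n k) (hprod : ∀ k, d k ≤ ∏ l ∈ Finset.univ.erase k, d l)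
    (b : ChartIndex n d) :
    ∃ s ∈ tuckerChartAlgebra R n d, s ≠ 0 ∧ s * MvPolynomial.X b ∈ tuckerChartAlgebra R n d := by
  let x : ChartIndex n d → MvPolynomial (ChartIndex n d) R := MvPolynomial.X
  have entry_mem (i) : tuckerChart n d x i ∈ tuckerChartAlgebra R n d :=
    Algebra.subset_adjoin ⟨i, rfl⟩
  have core_mem (j) : x (Sum.inr j) ∈ tuckerChartAlgebra R n d :=
    tuckerChart_castLE hd x j ▸ entry_mem _
  rcases b with ⟨k, i, j⟩ | j
  · obtain ⟨c⟩ : Nonempty (Fin (d k) ↪ ∀ l : {l : Fin r // l ≠ k}, Fin (d l)) :=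
      Function.Embedding.nonempty_of_card_le (by
        simpa only [card_multiIndex_except, Fintype.card_fin] using hprod k)
    let coreIndex (a b : Fin (d k)) : ChartIndex n d :=
      Sum.inr ((Equiv.piSplitAt k fun l => Fin (d l)).symm (a, c b))
    have coreIndex_injective : Function.Injective2 coreIndex := fun a a' b b' h => by
      simpa [coreIndex] using h
    have row_mem (b) : Matrix.vecMul (chartFactor x k i)
        (Matrix.of fun a b => x (coreIndex a b)) b ∈ tuckerChartAlgebra R n d := by
      have entry := entry_mem ((Equiv.piSplitAt k fun l => Fin (n l)).symm
        (i, fun l => Fin.castLE (hd l) (c b l)))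
      rwa [tuckerChart_fiber] at entry
    have core_det_mul_mem := det_mul_mem_of_vecMul_mem (fun a b => core_mem _) row_mem j
    rw [chartFactor_of_le] at core_det_mul_mem
    exact ⟨_, det_mem fun a b => core_mem _, det_of_X_ne_zero coreIndex_injective,
      core_det_mul_mem⟩
  · exact ⟨1, one_mem _, one_ne_zero, by simpa using core_mem j⟩

theorem realAlgebraicDim_tuckerImage (hd : ∀ k, d k ≤ n k)
    (hprod : ∀ k, d k ≤ ∏ l ∈ Finset.univ.erase k, d l) :
    realAlgebraicDim (tuckerImage n d) = Nat.card (ChartIndex n d) := by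
  have halg : Algebra.IsAlgebraic (tuckerChartAlgebra ℝ n d) (MvPolynomial (ChartIndex n d) ℝ) :=
    isAlgebraic_of_exists_mul_mem MvPolynomial.adjoin_range_X <| Set.forall_mem_range.mpr
      (exists_mul_X_mem_tuckerChartAlgebra hd hprod)
  have hchart : tuckerChart (R := ℝ) n d =
      fun x i => MvPolynomial.eval x (tuckerChart n d MvPolynomial.X i) := by
    funext x i
    rw [map_tuckerChart]
    congr 1
    funext b
    simp
  rw [realAlgebraicDim, vanishingIdeal_tuckerImage hd, hchart]
  exact ringKrullDim_quotient_vanishingIdeal_range_eval _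

theorem card_chartIndex (hd : ∀ k, d k ≤ n k) :
    (Nat.card (ChartIndex n d) : ℤ) =
      ∑ k, ((d k : ℤ) * (n k : ℤ) - (d k : ℤ) ^ 2) + ∏ k, (d k : ℤ) := by
  have card_free_rows (k) : Fintype.card {i : Fin (n k) // d k ≤ (i : ℕ)} = n k - d k := by
    have hcompl := Fintype.card_subtype_compl fun i : Fin (n k) => (i : ℕ) < d k
    have hcard := Fin.card_filter_val_lt (n := n k) (m := d k)
    rw [← Fintype.card_subtype] at hcard
    simpa [hcard, hd k] using hcompl
  simp only [Nat.card_eq_fintype_card, Fintype.card_sum, Fintype.card_sigma, Fintype.card_prod,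
    card_free_rows, Fintype.card_fin, Fintype.card_pi]
  push_cast [Nat.cast_sub (hd _)]
  congr 1
  exact Finset.sum_congr rfl fun k _ => by ring

end Chart

theorem mainTheorem9_general {r : ℕ} (n m : Fin r → ℕ) :
    tuckerImage n m = tuckerVariety n (effectiveRank (m ⊓ n)) ∧
      ∃ D : ℕ, realAlgebraicDim (tuckerImage n m) = (D : WithBot ℕ∞) ∧
        (D : ℤ) =
          ∑ k, ((effectiveRank (m ⊓ n) k : ℤ) * (n k : ℤ) - (effectiveRank (m ⊓ n) k : ℤ) ^ 2) +
            ∏ k, (effectiveRank (m ⊓ n) k : ℤ) := by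
  have hd : effectiveRank (m ⊓ n) ≤ n := (effectiveRank_le _).trans inf_le_right
  have himage : tuckerImage n m = tuckerVariety n (effectiveRank (m ⊓ n)) := by
    rw [tuckerVariety_effectiveRank, tuckerVariety_inf, tuckerImage_eq_tuckerVariety]
  refine ⟨himage, Nat.card (ChartIndex n (effectiveRank (m ⊓ n))), ?_, card_chartIndex hd⟩
  rw [himage, ← tuckerImage_eq_tuckerVariety]
  exact realAlgebraicDim_tuckerImage hd (effectiveRank_le_prod_erase _)

theorem mainTheorem9 {r : ℕ} (n m : Fin r → ℕ) (hmn : ∀ k, m k ≤ n k) :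
    tuckerImage n m = tuckerVariety n (effectiveRank m) ∧
      ∃ D : ℕ, realAlgebraicDim (tuckerImage n m) = (D : WithBot ℕ∞) ∧
        (D : ℤ) =
          ∑ k, ((effectiveRank m k : ℤ) * (n k : ℤ) - (effectiveRank m k : ℤ) ^ 2) +
            ∏ k, (effectiveRank m k : ℤ) := by
  simpa only [inf_eq_left.mpr (show m ≤ n from hmn)] using mainTheorem9_general n m
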